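/- Let $\pi=\tfrac12\sum_{i,j}p_{ij}\,\partial_i\wedge\partial_j$ be a non-zero Poisson structure on $\mathbb R^n$ whose coefficients $p_{ij}=\{x_i,x_j\}$ are homogeneous polynomials of degree $h\ge 0$ (a non-trivial $h$-homogeneous Poisson structure), and let $\overline{\mathfrak g}=\mathbb R[x_1,\dots,x_n]/\mathbb R$ be the Lie algebra of polynomials modulo constants, with the bracket induced by the Poisson bracket. Let $S_j^*$ ($j\ge 1$) denote the dual of the space of homogeneous polynomials of degree $j$. For $m\ge 0$ and $w\in\mathbb Z$ let $$\overline C^{\,m}_w=\bigoplus \Lambda^{k_1}S_1^*\otimes\Lambda^{k_2}S_2^*\otimes\cdots ,$$ the sum being over all sequences $k_1,k_2,\dots\ge 0$ with $\sum_j k_j=m$ and $\sum_j (j-2+h)k_j=w$; this is the space of $m$-cochains of weight $w$ of $\overline{\mathfrak g}$. The Lie algebra coboundary operator (trivial coefficients) $$(d\sigma)(u_0,\dots,u_m)=\sum_{a<b}(-1)^{a+b}\,\sigma([u_a,u_b],\dots,\widehat{u_a},\dots,\widehat{u_b},\dots)$$ preserves the weight, and we put $H^m_w(\overline{\mathfrak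 g})=\operatorname{Ker}(d:\overline C^{\,m}_w\to\overline C^{\,m+1}_w)/d(\overline C^{\,m-1}_w)$. Let $\ell\ge 1$ be an integer with $h+\ell\ge 3$ and put $$w=\sum_{j=1}^{\ell}(j-2+h)\binom{n-1+j}{j},\qquad m_0=\sum_{j=1}^{\ell}\binom{n-1+j}{j}.$$ Then $m_0$ is the largest $m$ with $\overline C^{\,m}_w\neq 0$, the top cochain space $\overline C^{\,m_0}_w$ is one-dimensional, and the top Betti number $\dim H^{m_0}_w(\overline{\mathfrak g})$ is $0$. -/

import Mathlib

open MvPolynomial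

noncomputable section

/-! ### The Chevalley-Eilenberg coboundary with trivial real coefficients -/

section ChevalleyEilenberg

/-- The bilinear map `(x, y) ↦ σ(⁅x, y⁆, ·, …, ·)`. -/
def ceBracketInsert {L : Type*} [LieRing L] [LieAlgebra ℝ L] {k : ℕ}
    (σ : L [⋀^Fin (k + 1)]→ₗ[ℝ] ℝ) : L →ₗ[ℝ] L →ₗ[ℝ] L [⋀^Fin k]→ₗ[ℝ] ℝ :=
  (LieModule.toEnd ℝ L L : L →ₗ[ℝ] Module.End ℝ L).compr₂ σ.curryLeft

/-- `∑_{a < b} (-1)^(a+b) σ(⁅v_a, v_b⁆, v_0, …, v̂_a, …, v̂_b, …, v_(k+1))`. The pairs `a < b` in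
`Fin (k + 2)` are written as `a = i.castSucc`, `b = j.succ` with `i ≤ j` in `Fin (k + 1)`; after
`v_a` has been removed, `v_b` stands at place `j`. -/
def ceSum {L : Type*} [LieRing L] [LieAlgebra ℝ L] {k : ℕ}
    (σ : L [⋀^Fin (k + 1)]→ₗ[ℝ] ℝ) (v : Fin (k + 2) → L) : ℝ :=
  ∑ i : Fin (k + 1), ∑ j ∈ Finset.univ.filter (fun j : Fin (k + 1) => i ≤ j),
    (-1 : ℝ) ^ ((i.castSucc : ℕ) + (j.succ : ℕ)) *
      σ (Matrix.vecCons ⁅v i.castSucc, v j.succ⁆ (j.removeNth (i.castSucc.removeNth v)))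

theorem ceSum_eq {L : Type*} [LieRing L] [LieAlgebra ℝ L] {k : ℕ}
    (σ : L [⋀^Fin (k + 1)]→ₗ[ℝ] ℝ) (v : Fin (k + 2) → L) :
    ceSum σ v = ((-(1 / 2 : ℝ)) • AlternatingMap.alternatizeUncurryFin
      (AlternatingMap.alternatizeUncurryFinLM ∘ₗ ceBracketInsert σ)) v := by
  rw [AlternatingMap.smul_apply,
    AlternatingMap.alternatizeUncurryFin_alternatizeUncurryFinLM_comp_apply, ceSum,
    Finset.smul_sum]
  refine Finset.sum_congr rfl fun i _ => ?_
  rw [Finset.smul_sum]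
  refine Finset.sum_congr (by ext; simp) fun j _ => ?_
  have h : ∀ x y : L, ∀ r : Fin k → L,
      ceBracketInsert σ x y r = σ (Matrix.vecCons ⁅x, y⁆ r) := fun x y r => rfl
  have hs : ∀ x y : L, ∀ r : Fin k → L,
      ceBracketInsert σ y x r = - ceBracketInsert σ x y r := by
    intro x y r
    have : ceBracketInsert σ y x = - ceBracketInsert σ x y := by
      change σ.curryLeft ⁅y, x⁆ = - σ.curryLeft ⁅x, y⁆
      rw [← lie_skew, map_neg]
    rw [this]; rfl
  rw [hs (v i.castSucc) (v j.succ), h]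
  simp only [Fin.val_castSucc, Fin.val_succ, zsmul_eq_mul, smul_eq_mul]
  push_cast
  ring

/-- The coboundary `d` from `(k+1)`-cochains to `(k+2)`-cochains. -/
def ceCoboundarySucc (L : Type*) [LieRing L] [LieAlgebra ℝ L] (k : ℕ) :
    (L [⋀^Fin (k + 1)]→ₗ[ℝ] ℝ) →ₗ[ℝ] (L [⋀^Fin (k + 2)]→ₗ[ℝ] ℝ) where
  toFun σ :=
    { toFun := ceSum σ
      map_update_add' := by
        intro _ v i x y
        simp only [ceSum_eq]
        exact AlternatingMap.map_update_add _ v i x y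
      map_update_smul' := by
        intro _ v i c x
        simp only [ceSum_eq]
        exact AlternatingMap.map_update_smul _ v i c x
      map_eq_zero_of_eq' := by
        intro v i j hv hij
        simp only [ceSum_eq]
        exact AlternatingMap.map_eq_zero_of_eq _ v hv hij }
  map_add' σ τ := by
    ext v
    change ceSum (σ + τ) v = ceSum σ v + ceSum τ v
    simp only [ceSum, AlternatingMap.add_apply, mul_add, Finset.sum_add_distrib]
  map_smul' c σ := by
    ext v
    change ceSum (c • σ) v = c * ceSum σ v
    simp only [ceSum, AlternatingMap.smul_apply, smul_eq_mul, Finset.mul_sum]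
    refine Finset.sum_congr rfl fun i _ => Finset.sum_congr rfl fun j _ => ?_
    ring

/-- The coboundary operator on the alternating real forms of a real Lie algebra (trivial
coefficients); it is zero on `0`-cochains. -/
def ceCoboundary (L : Type*) [LieRing L] [LieAlgebra ℝ L] :
    (m : ℕ) → (L [⋀^Fin m]→ₗ[ℝ] ℝ) →ₗ[ℝ] (L [⋀^Fin (m + 1)]→ₗ[ℝ] ℝ)
  | 0 => 0
  | k + 1 => ceCoboundarySucc L k

/-- The wedge product `φ_1 ∧ … ∧ φ_m` of linear forms, `(v_1, …, v_m) ↦ det (φ_j (v_i))`. -/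
def wedgeForms {L : Type*} [AddCommGroup L] [Module ℝ L] {m : ℕ}
    (φ : Fin m → Module.Dual ℝ L) : L [⋀^Fin m]→ₗ[ℝ] ℝ :=
  (Matrix.detRowAlternating (n := Fin m) (R := ℝ)).compLinearMap (LinearMap.pi φ)

theorem wedgeForms_apply {L : Type*} [AddCommGroup L] [Module ℝ L] {m : ℕ}
    (φ : Fin m → Module.Dual ℝ L) (v : Fin m → L) :
    wedgeForms φ v = Matrix.det (Matrix.of fun i j => φ j (v i)) := rfl

/-- The quotient `Z / (B ∩ Z)` of two subspaces of a real vector space; `Z / B` if `B ≤ Z`. -/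
def Subquotient {V : Type*} [AddCommGroup V] [Module ℝ V] (Z B : Submodule ℝ V) : Type _ :=
  ↥Z ⧸ B.submoduleOf Z

instance {V : Type*} [AddCommGroup V] [Module ℝ V] (Z B : Submodule ℝ V) :
    AddCommGroup (Subquotient Z B) :=
  inferInstanceAs (AddCommGroup (↥Z ⧸ B.submoduleOf Z))

instance {V : Type*} [AddCommGroup V] [Module ℝ V] (Z B : Submodule ℝ V) :
    Module ℝ (Subquotient Z B) :=
  inferInstanceAs (Module ℝ (↥Z ⧸ B.submoduleOf Z))

end ChevalleyEilenberg

/-! ### Polynomial Poisson structures on `ℝⁿ` -/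

/-- A Poisson structure `π = ½ ∑ p_ij ∂_i ∧ ∂_j` on `ℝⁿ` with polynomial coefficients. The field
`jacobi` is the vanishing of the Schouten bracket of `π` with itself, in coordinates. -/
structure PolyPoisson (n : ℕ) where
  /-- the coefficients `p_ij = {x_i, x_j}` -/
  p : Fin n → Fin n → MvPolynomial (Fin n) ℝ
  skew : ∀ i j, p j i = - p i j
  jacobi : ∀ i j k, ∑ l, (p k l * pderiv l (p i j) + p i l * pderiv l (p j k)
    + p j l * pderiv l (p k i)) = 0

namespace PolyPoisson

variable {n : ℕ}

/-- All coefficients are homogeneous polynomials of degree `h`. -/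
def IsHomog (π : PolyPoisson n) (h : ℕ) : Prop := ∀ i j, (π.p i j).IsHomogeneous h

/-- The Poisson structure is not identically zero. -/
def Nontrivial (π : PolyPoisson n) : Prop := ∃ i j, π.p i j ≠ 0

/-- The Poisson bracket `{f, g} = π(df, dg)`. -/
def bracket (π : PolyPoisson n) (f g : MvPolynomial (Fin n) ℝ) : MvPolynomial (Fin n) ℝ :=
  ∑ i, ∑ j, π.p i j * pderiv i f * pderiv j g

/-- `{f, ·}` as a derivation. -/
def ham (π : PolyPoisson n) (f : MvPolynomial (Fin n) ℝ) :
    Derivation ℝ (MvPolynomial (Fin n) ℝ) (MvPolynomial (Fin n) ℝ) :=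
  ∑ i, ∑ j, (π.p i j * pderiv i f) • pderiv j

theorem ham_apply (π : PolyPoisson n) (f g : MvPolynomial (Fin n) ℝ) :
    π.ham f g = π.bracket f g := by
  have e : ∀ (s : Finset (Fin n))
      (D : Fin n → Derivation ℝ (MvPolynomial (Fin n) ℝ) (MvPolynomial (Fin n) ℝ)),
      (∑ i ∈ s, D i) g = ∑ i ∈ s, D i g := by
    intro s D
    rw [← Derivation.coeFnAddMonoidHom_apply, map_sum, Finset.sum_apply]
    rfl
  simp only [ham, bracket, e, Derivation.smul_apply, smul_eq_mul]

theorem bracket_skew (π : PolyPoisson n) (f g : MvPolynomial (Fin n) ℝ) :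
    π.bracket g f = - π.bracket f g := by
  unfold bracket
  rw [Finset.sum_comm, ← Finset.sum_neg_distrib]
  refine Finset.sum_congr rfl fun i _ => ?_
  rw [← Finset.sum_neg_distrib]
  refine Finset.sum_congr rfl fun j _ => ?_
  rw [π.skew i j]
  ring

theorem bracket_self (π : PolyPoisson n) (f : MvPolynomial (Fin n) ℝ) : π.bracket f f = 0 :=
  self_eq_neg.mp (π.bracket_skew f f)

theorem bracket_X_left (π : PolyPoisson n) (k : Fin n) (g : MvPolynomial (Fin n) ℝ) :
    π.bracket (X k) g = ∑ j, π.p k j * pderiv j g := by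
  unfold bracket
  rw [Finset.sum_eq_single k]
  · simp
  · intro b _ hb
    simp [pderiv_X_of_ne hb.symm]
  · simp

theorem bracket_X_X (π : PolyPoisson n) (i j : Fin n) : π.bracket (X i) (X j) = π.p i j := by
  rw [bracket_X_left, Finset.sum_eq_single j]
  · simp
  · intro b _ hb
    simp [pderiv_X_of_ne hb.symm]
  · simp

theorem bracket_add_right (π : PolyPoisson n) (f g g' : MvPolynomial (Fin n) ℝ) :
    π.bracket f (g + g') = π.bracket f g + π.bracket f g' := by
  simp only [← ham_apply, map_add]

theorem bracket_smul_right (π : PolyPoisson n) (c : ℝ) (f g : MvPolynomial (Fin n) ℝ) :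
    π.bracket f (c • g) = c • π.bracket f g := by
  simp only [← ham_apply]
  exact (π.ham f).map_smul c g

theorem bracket_add_left (π : PolyPoisson n) (f f' g : MvPolynomial (Fin n) ℝ) :
    π.bracket (f + f') g = π.bracket f g + π.bracket f' g := by
  rw [bracket_skew π g, bracket_add_right, neg_add, ← bracket_skew, ← bracket_skew]

/-- The Jacobi identity in `f, g` and a coordinate function follows from the one in coordinate
functions, because both sides are derivations. -/
theorem ham_comm_of_X (π : PolyPoisson n) (f g : MvPolynomial (Fin n) ℝ)
    (H : ∀ k, π.bracket f (π.bracket g (X k)) =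
      π.bracket (π.bracket f g) (X k) + π.bracket g (π.bracket f (X k))) :
    ∀ u, π.bracket f (π.bracket g u) =
      π.bracket (π.bracket f g) u + π.bracket g (π.bracket f u) := by
  have hD : ⁅π.ham f, π.ham g⁆ = π.ham (π.bracket f g) := by
    refine MvPolynomial.derivation_ext fun k => ?_
    rw [Derivation.commutator_apply]
    simp only [ham_apply]
    rw [H k]; ring
  intro u
  have := congrArg (fun D => D u) hD
  simp only [Derivation.commutator_apply, ham_apply] at this
  rw [← this]; ring

theorem bracket_neg_right (π : PolyPoisson n) (f g : MvPolynomial (Fin n) ℝ) :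
    π.bracket f (-g) = - π.bracket f g := by
  simp only [← ham_apply, map_neg]

theorem bracket_neg_left (π : PolyPoisson n) (f g : MvPolynomial (Fin n) ℝ) :
    π.bracket (-f) g = - π.bracket f g := by
  rw [bracket_skew π g, bracket_neg_right, ← bracket_skew]

/-- The Jacobi identity in Leibniz form. -/
theorem bracket_leibniz (π : PolyPoisson n) (f g u : MvPolynomial (Fin n) ℝ) :
    π.bracket f (π.bracket g u) =
      π.bracket (π.bracket f g) u + π.bracket g (π.bracket f u) := by
  -- moving an argument to the last place
  have rot : ∀ a b c : MvPolynomial (Fin n) ℝ,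
      π.bracket b (π.bracket c a) = π.bracket (π.bracket b c) a + π.bracket c (π.bracket b a) →
      π.bracket a (π.bracket b c) = π.bracket (π.bracket a b) c + π.bracket b (π.bracket a c) := by
    intro a b c h
    rw [bracket_skew π (π.bracket b c) a, bracket_skew π c (π.bracket a b), bracket_skew π c a,
      bracket_neg_right, bracket_skew π b a, bracket_neg_right, h]
    ring
  have h0 : ∀ i j k : Fin n, π.bracket (X i) (π.bracket (X j) (X k)) =
      π.bracket (π.bracket (X i) (X j)) (X k) + π.bracket (X j) (π.bracket (X i) (X k)) := by
    intro i j k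
    have hJ := π.jacobi i j k
    rw [Finset.sum_add_distrib, Finset.sum_add_distrib] at hJ
    rw [bracket_skew π (X k) (π.bracket (X i) (X j))]
    simp only [bracket_X_X]
    rw [bracket_X_left, bracket_X_left, bracket_X_left, π.skew k i]
    simp only [map_neg, mul_neg, Finset.sum_neg_distrib]
    linear_combination hJ
  have h1 : ∀ (i j : Fin n) (c : MvPolynomial (Fin n) ℝ), π.bracket (X i) (π.bracket (X j) c) =
      π.bracket (π.bracket (X i) (X j)) c + π.bracket (X j) (π.bracket (X i) c) :=
    fun i j => ham_comm_of_X π _ _ (h0 i j)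
  have h2 : ∀ (i : Fin n) (b c : MvPolynomial (Fin n) ℝ), π.bracket (X i) (π.bracket b c) =
      π.bracket (π.bracket (X i) b) c + π.bracket b (π.bracket (X i) c) :=
    fun i b => ham_comm_of_X π _ _ fun k => rot _ _ _ (rot _ _ _ (h1 k i b))
  exact ham_comm_of_X π f g (fun k => rot _ _ _ (rot _ _ _ (h2 k f g))) u

theorem bracket_const_right (π : PolyPoisson n) (f : MvPolynomial (Fin n) ℝ) (c : ℝ) :
    π.bracket f (algebraMap ℝ (MvPolynomial (Fin n) ℝ) c) = 0 := by
  rw [← ham_apply]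
  exact Derivation.map_algebraMap _ c

/-- The polynomial algebra `ℝ[x_1, …, x_n]`, as a Lie algebra under the Poisson bracket of `π`. -/
def PolyLie (_π : PolyPoisson n) : Type := MvPolynomial (Fin n) ℝ

instance (π : PolyPoisson n) : AddCommGroup π.PolyLie :=
  inferInstanceAs (AddCommGroup (MvPolynomial (Fin n) ℝ))

instance (π : PolyPoisson n) : Module ℝ π.PolyLie :=
  inferInstanceAs (Module ℝ (MvPolynomial (Fin n) ℝ))

instance (π : PolyPoisson n) : LieRing π.PolyLie where
  bracket f g := π.bracket f g
  add_lie := π.bracket_add_left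
  lie_add := π.bracket_add_right
  lie_self := π.bracket_self
  leibniz_lie := π.bracket_leibniz

instance (π : PolyPoisson n) : LieAlgebra ℝ π.PolyLie where
  lie_smul := π.bracket_smul_right

/-- The constant polynomials `ℝ`, a (central) ideal. -/
def constIdeal (π : PolyPoisson n) : LieIdeal ℝ π.PolyLie where
  toSubmodule := (1 : Submodule ℝ (MvPolynomial (Fin n) ℝ))
  lie_mem := by
    intro f g hg
    obtain ⟨c, rfl⟩ := Submodule.mem_one.mp hg
    change π.bracket f (algebraMap ℝ (MvPolynomial (Fin n) ℝ) c) ∈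
      (1 : Submodule ℝ (MvPolynomial (Fin n) ℝ))
    rw [π.bracket_const_right f c]
    exact Submodule.zero_mem _

/-- The Lie algebra `ḡ = ℝ[x_1, …, x_n] / ℝ`. -/
def gbar (π : PolyPoisson n) : Type := π.PolyLie ⧸ π.constIdeal

instance (π : PolyPoisson n) : LieRing π.gbar :=
  inferInstanceAs (LieRing (π.PolyLie ⧸ π.constIdeal))

instance (π : PolyPoisson n) : LieAlgebra ℝ π.gbar :=
  inferInstanceAs (LieAlgebra ℝ (π.PolyLie ⧸ π.constIdeal))

/-- The class in `ḡ` of a polynomial. -/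
def toGbar (π : PolyPoisson n) : MvPolynomial (Fin n) ℝ →ₗ[ℝ] π.gbar :=
  (π.constIdeal.toSubmodule.mkQ : π.PolyLie →ₗ[ℝ] π.gbar)

/-- The linear forms on `ḡ` that vanish on the homogeneous polynomials of every degree other than
`j`. Since `ḡ = ⨁_{j ≥ 1} S_j` (`S_j` the homogeneous polynomials of degree `j`), this is the dual
space `S_j^*` if `j ≥ 1`; it is zero if `j = 0`. -/
def dualPart (π : PolyPoisson n) (j : ℕ) : Submodule ℝ (Module.Dual ℝ π.gbar) where
  carrier := {φ | ∀ i, i ≠ j → ∀ f : MvPolynomial (Fin n) ℝ, f.IsHomogeneous i →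
    φ (π.toGbar f) = 0}
  add_mem' := by
    intro φ ψ hφ hψ i hi f hf
    rw [LinearMap.add_apply, hφ i hi f hf, hψ i hi f hf, add_zero]
  zero_mem' := fun _ _ _ _ => rfl
  smul_mem' := by
    intro c φ hφ i hi f hf
    rw [LinearMap.smul_apply, hφ i hi f hf, smul_zero]

/-- The space of `m`-cochains of weight `w`, that is `∑ Λ^{k_1} S_1^* ⊗ Λ^{k_2} S_2^* ⊗ ⋯` over
all `k` with `∑ k_j = m` and `∑ k_j (j - 2 + h) = w`: it is spanned by the products
`φ_1 ∧ … ∧ φ_m` with `φ_i ∈ S_{a_i}^*` and `∑ (a_i - 2 + h) = w`. -/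
def cochains (π : PolyPoisson n) (h m : ℕ) (w : ℤ) :
    Submodule ℝ (π.gbar [⋀^Fin m]→ₗ[ℝ] ℝ) :=
  Submodule.span ℝ {σ | ∃ (a : Fin m → ℕ) (φ : Fin m → Module.Dual ℝ π.gbar),
    (∀ i, φ i ∈ π.dualPart (a i)) ∧ (∑ i, ((a i : ℤ) - 2 + (h : ℤ)) = w) ∧ σ = wedgeForms φ}

/-- `Ker (d : C^m_w → C^{m+1}_w)`. -/
def cocycles (π : PolyPoisson n) (h m : ℕ) (w : ℤ) :
    Submodule ℝ (π.gbar [⋀^Fin m]→ₗ[ℝ] ℝ) :=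
  π.cochains h m w ⊓ LinearMap.ker (ceCoboundary π.gbar m)

/-- `d (C^{m-1}_w)`; there are no cochains of degree `-1`. -/
def coboundaries (π : PolyPoisson n) (h : ℕ) :
    (m : ℕ) → ℤ → Submodule ℝ (π.gbar [⋀^Fin m]→ₗ[ℝ] ℝ)
  | 0, _ => ⊥
  | m + 1, w => (π.cochains h m w).map (ceCoboundary π.gbar m)

/-- The cohomology `H^m_w(ḡ) = Ker (d : C^m_w → C^{m+1}_w) / d (C^{m-1}_w)`. -/
abbrev Cohomology (π : PolyPoisson n) (h m : ℕ) (w : ℤ) : Type :=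
  Subquotient (π.cocycles h m w) (π.coboundaries h m w)

end PolyPoisson

end

/-! ### Monomials of bounded positive degree -/

/-! A form of weight `w` in `m` arguments is determined by its values on sets of `m` distinct
non-constant monomials of total weight `w`. Let `E` be the set of all monomials of degree 1 to `l`;
it has `m₀` elements and weight `w`. A set at least as large as `E` is obtained by trading monomials
of weight at most `l - 2 + h` for at least as many of weight at least `l - 1 + h`. This raises the
weight unless nothing is traded (`eq_monomialsUpTo_of_weight`). Hence nothing survives above `m₀`,
and the forms in degree `m₀` are multiples of the product `top` of the coordinates of `E`.

It remains to make `top` a coboundary. Take `p_ij ≠ 0`, `a = x_i^l`, `b = x_j^l`. Then `{a, b} = l²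
x_i^(l-1) x_j^(l-1) p_ij` is non-zero of degree `2l - 2 + h`, which exceeds `l` because `h + l ≥ 3`.
So any monomial `ν` occurring in it lies outside `E`. Replacing the coordinates of `a` and `b` in
`top` by that of `ν` keeps the weight and gives a cochain `τ`. Its coboundary is a multiple of
`top`, and evaluation on the monomials of `E` shows that the factor is, up to sign, the coefficient
of `ν` in `{a, b}` (`ceCoboundary_wedgeForms_coordForm_apply`). -/

/-- The exponents of the non-constant monomials of degree at most `l` in `n` variables. -/
noncomputable def monomialsUpTo (n l : ℕ) : Finset (Fin n →₀ ℕ) :=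
  (Finset.Icc 1 l).biUnion fun j => Finset.univ.finsuppAntidiag j

theorem mem_finsuppAntidiag_univ_iff {n j : ℕ} {s : Fin n →₀ ℕ} :
    s ∈ (Finset.univ : Finset (Fin n)).finsuppAntidiag j ↔ s.degree = j := by
  rw [Finset.mem_finsuppAntidiag, Finsupp.degree_eq_sum]
  simp

theorem mem_monomialsUpTo {n l : ℕ} {s : Fin n →₀ ℕ} :
    s ∈ monomialsUpTo n l ↔ 1 ≤ s.degree ∧ s.degree ≤ l := by
  simp only [monomialsUpTo, Finset.mem_biUnion, mem_finsuppAntidiag_univ_iff, Finset.mem_Icc]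
  exact ⟨by rintro ⟨j, hj, rfl⟩; exact hj, fun hs => ⟨_, hs, rfl⟩⟩

theorem pairwiseDisjoint_finsuppAntidiag_univ (n : ℕ) (t : Set ℕ) :
    t.PairwiseDisjoint fun j => (Finset.univ : Finset (Fin n)).finsuppAntidiag j := by
  intro i _ j _ hij
  rw [Function.onFun, Finset.disjoint_left]
  intro s hi hj
  rw [mem_finsuppAntidiag_univ_iff] at hi hj
  exact hij (hi.symm.trans hj)

theorem card_monomialsUpTo (n l : ℕ) :
    (monomialsUpTo n l).card = ∑ j ∈ Finset.Icc 1 l, (n + j - 1).choose j := by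
  rw [monomialsUpTo, Finset.card_biUnion (pairwiseDisjoint_finsuppAntidiag_univ n _)]
  exact Finset.sum_congr rfl fun j _ => by
    rw [Finset.card_finsuppAntidiag_nat_eq_choose, Finset.card_univ, Fintype.card_fin]

theorem sum_weight_monomialsUpTo (n h l : ℕ) :
    ∑ s ∈ monomialsUpTo n l, ((s.degree : ℤ) - 2 + (h : ℤ)) =
      ∑ j ∈ Finset.Icc 1 l, ((j : ℤ) - 2 + (h : ℤ)) * (((n + j - 1).choose j : ℕ) : ℤ) := by
  rw [monomialsUpTo, Finset.sum_biUnion (pairwiseDisjoint_finsuppAntidiag_univ n _)]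
  refine Finset.sum_congr rfl fun j _ => ?_
  rw [Finset.sum_congr rfl fun s hs => by rw [mem_finsuppAntidiag_univ_iff.mp hs],
    Finset.sum_const, Finset.card_finsuppAntidiag_nat_eq_choose, Finset.card_univ,
    Fintype.card_fin, nsmul_eq_mul, mul_comm]

/-- Among the sets of at least as many non-constant monomials, the set of all those of degree at
most `l` is the only one of its weight. -/
theorem eq_monomialsUpTo_of_weight {n h l : ℕ} (hhl : 3 ≤ h + l) {A : Finset (Fin n →₀ ℕ)}
    (hA : ∀ s ∈ A, s ≠ 0) (hcard : (monomialsUpTo n l).card ≤ A.card)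
    (hw : ∑ s ∈ A, ((s.degree : ℤ) - 2 + (h : ℤ)) =
      ∑ s ∈ monomialsUpTo n l, ((s.degree : ℤ) - 2 + (h : ℤ))) :
    A = monomialsUpTo n l := by
  set E := monomialsUpTo n l
  have hAE : ((A \ E).card : ℤ) * ((l : ℤ) - 1 + h) ≤
      ∑ s ∈ A \ E, ((s.degree : ℤ) - 2 + (h : ℤ)) := by
    rw [← nsmul_eq_mul]
    refine Finset.card_nsmul_le_sum _ _ _ fun s hs => ?_
    rw [Finset.mem_sdiff, mem_monomialsUpTo] at hs
    have h0 : s.degree ≠ 0 := fun h0 => hA s hs.1 ((Finsupp.degree_eq_zero_iff s).mp h0)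
    omega
  have hEA : ∑ s ∈ E \ A, ((s.degree : ℤ) - 2 + (h : ℤ)) ≤
      ((E \ A).card : ℤ) * ((l : ℤ) - 2 + h) := by
    rw [← nsmul_eq_mul]
    refine Finset.sum_le_card_nsmul _ _ _ fun s hs => ?_
    rw [Finset.mem_sdiff, mem_monomialsUpTo] at hs
    omega
  have h1 := Finset.sum_sdiff_sub_sum_sdiff (s₁ := A) (s₂ := E)
    (f := fun s : Fin n →₀ ℕ => (s.degree : ℤ) - 2 + (h : ℤ))
  have h2 := Finset.card_sdiff_add_card_inter A E
  have h3 := Finset.card_sdiff_add_card_inter E A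
  rw [Finset.inter_comm] at h3
  have h4 : (((E \ A).card : ℕ) : ℤ) ≤ (A \ E).card := by omega
  -- The two bounds and `h4` give `|A \ E| (l - 1 + h) ≤ |A \ E| (l - 2 + h)`; passing from `|E \
  -- A|` to `|A \ E|` needs `l - 2 + h ≥ 0`.
  have h5 : ((A \ E).card : ℤ) ≤ 0 := by nlinarith
  have h6 : (A \ E).card = 0 := by omega
  have h7 : (E \ A).card = 0 := by omega
  rw [Finset.card_eq_zero, Finset.sdiff_eq_empty_iff_subset] at h6 h7
  exact h6.antisymm h7

namespace PolyPoisson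

variable {n : ℕ}

/-! ### Homogeneous elements and coordinate forms -/

theorem toGbar_surjective (π : PolyPoisson n) : Function.Surjective π.toGbar :=
  π.constIdeal.toSubmodule.mkQ_surjective

theorem toGbar_C (π : PolyPoisson n) (c : ℝ) : π.toGbar (C c) = 0 :=
  (Submodule.Quotient.mk_eq_zero π.constIdeal.toSubmodule).mpr (Submodule.mem_one.mpr ⟨c, rfl⟩)

theorem lie_toGbar (π : PolyPoisson n) (f g : MvPolynomial (Fin n) ℝ) :
    ⁅π.toGbar f, π.toGbar g⁆ = π.toGbar (π.bracket f g) := rfl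

/-- Two derivatives lower the degree by 2 and the coefficients raise it by `h`. A factor of degree 0
is constant and brackets to zero; setting this case aside keeps the degree a natural number. -/
theorem bracket_eq_zero_or_isHomogeneous {π : PolyPoisson n} {h : ℕ} (hπ : π.IsHomog h)
    {f g : MvPolynomial (Fin n) ℝ} {a b : ℕ} (hf : f.IsHomogeneous a) (hg : g.IsHomogeneous b) :
    π.bracket f g = 0 ∨ ∃ c : ℕ, (c : ℤ) = a + b - 2 + h ∧ (π.bracket f g).IsHomogeneous c := by
  rcases Nat.eq_zero_or_pos a with rfl | ha
  · left
    rw [← totalDegree_zero_iff_isHomogeneous, totalDegree_eq_zero_iff_eq_C] at hf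
    rw [hf, bracket_skew, ← algebraMap_eq, bracket_const_right, neg_zero]
  rcases Nat.eq_zero_or_pos b with rfl | hb
  · left
    rw [← totalDegree_zero_iff_isHomogeneous, totalDegree_eq_zero_iff_eq_C] at hg
    rw [hg, ← algebraMap_eq, bracket_const_right]
  refine Or.inr ⟨h + (a - 1) + (b - 1), by omega, ?_⟩
  exact IsHomogeneous.sum _ _ _ fun i _ => IsHomogeneous.sum _ _ _ fun j _ =>
    ((hπ i j).mul hf.pderiv).mul hg.pderiv

/-- The linear form on `ḡ` which reads off the coefficient of the monomial `s`, for `s ≠ 0`. -/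
noncomputable def coordForm (π : PolyPoisson n) (s : Fin n →₀ ℕ) : Module.Dual ℝ π.gbar :=
  π.constIdeal.toSubmodule.liftQ
    -- The constant coefficient does not descend to the quotient by constants, hence the default
    -- value 0.
    (if s = 0 then 0 else (lcoeff ℝ s : MvPolynomial (Fin n) ℝ →ₗ[ℝ] ℝ)) <| by
    intro f hf
    obtain ⟨c, rfl⟩ := Submodule.mem_one.mp hf
    change (if s = 0 then 0 else (lcoeff ℝ s : MvPolynomial (Fin n) ℝ →ₗ[ℝ] ℝ)) (C c) = 0
    split_ifs with hs
    · rfl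
    · change coeff s (C c) = 0
      rw [coeff_C, if_neg (Ne.symm hs)]

theorem coordForm_toGbar (π : PolyPoisson n) {s : Fin n →₀ ℕ} (hs : s ≠ 0)
    (f : MvPolynomial (Fin n) ℝ) : π.coordForm s (π.toGbar f) = coeff s f := by
  change (if s = 0 then 0 else (lcoeff ℝ s : MvPolynomial (Fin n) ℝ →ₗ[ℝ] ℝ)) f = _
  rw [if_neg hs]
  rfl

theorem coordForm_mem_dualPart (π : PolyPoisson n) {s : Fin n →₀ ℕ} (hs : s ≠ 0) :
    π.coordForm s ∈ π.dualPart s.degree := by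
  intro i hi f hf
  rw [coordForm_toGbar π hs]
  exact hf.coeff_eq_zero (Ne.symm hi)

theorem wedgeForms_coordForm_mem_cochains (π : PolyPoisson n) {h m : ℕ} {w : ℤ}
    {e : Fin m → Fin n →₀ ℕ} (he : ∀ i, e i ≠ 0)
    (hw : ∑ i, (((e i).degree : ℤ) - 2 + (h : ℤ)) = w) :
    wedgeForms (fun i => π.coordForm (e i)) ∈ π.cochains h m w :=
  Submodule.subset_span ⟨fun i => (e i).degree, _,
    fun i => coordForm_mem_dualPart π (he i), hw, rfl⟩

/-- The class in `ḡ` of the monomial `s`. -/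
noncomputable def mono (π : PolyPoisson n) (s : Fin n →₀ ℕ) : π.gbar := π.toGbar (monomial s 1)

theorem coordForm_mono (π : PolyPoisson n) {s : Fin n →₀ ℕ} (hs : s ≠ 0) (t : Fin n →₀ ℕ) :
    π.coordForm s (π.mono t) = if t = s then 1 else 0 := by
  rw [mono, coordForm_toGbar π hs, coeff_monomial]

theorem mono_zero (π : PolyPoisson n) : π.mono 0 = 0 := π.toGbar_C 1

/-- Pulled back along the surjection from polynomials, alternating forms are compared on the
monomial basis; tuples containing the monomial 1 give zero because its class vanishes. -/
theorem alternatingMap_ext_mono {π : PolyPoisson n} {m : ℕ} {σ τ : π.gbar [⋀^Fin m]→ₗ[ℝ] ℝ}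
    (H : ∀ v : Fin m → Fin n →₀ ℕ, Function.Injective v → (∀ i, v i ≠ 0) →
      (σ fun i => π.mono (v i)) = τ fun i => π.mono (v i)) : σ = τ := by
  have key : σ.compLinearMap π.toGbar = τ.compLinearMap π.toGbar := by
    refine Module.Basis.ext_alternating (basisMonomials (Fin n) ℝ) fun v hv => ?_
    simp only [coe_basisMonomials, AlternatingMap.compLinearMap_apply]
    change (σ fun i => π.mono (v i)) = τ fun i => π.mono (v i)
    by_cases h0 : ∀ i, v i ≠ 0
    · exact H v hv h0
    · push Not at h0
      obtain ⟨i, hi⟩ := h0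
      have : (fun i => π.mono (v i)) i = 0 := by
        change π.mono (v i) = 0
        rw [hi, mono_zero]
      rw [σ.map_coord_zero i this, τ.map_coord_zero i this]
  exact AlternatingMap.compLinearMap_injective π.toGbar π.toGbar_surjective key

/-! ### Forms supported in one weight -/

/-- The alternating forms that vanish on all tuples of homogeneous elements whose total weight is
not `w`. -/
def weightForms (π : PolyPoisson n) (h m : ℕ) (w : ℤ) : Submodule ℝ (π.gbar [⋀^Fin m]→ₗ[ℝ] ℝ) where
  carrier := {σ | ∀ (b : Fin m → ℕ) (f : Fin m → MvPolynomial (Fin n) ℝ),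
    (∀ i, (f i).IsHomogeneous (b i)) → ∑ i, ((b i : ℤ) - 2 + (h : ℤ)) ≠ w →
      (σ fun i => π.toGbar (f i)) = 0}
  add_mem' := by
    intro σ τ hσ hτ b f hf hb
    rw [AlternatingMap.add_apply, hσ b f hf hb, hτ b f hf hb, add_zero]
  zero_mem' := fun _ _ _ _ => rfl
  smul_mem' := by
    intro c σ hσ b f hf hb
    rw [AlternatingMap.smul_apply, hσ b f hf hb, smul_zero]

/-- In each term of the determinant, if all the degrees of forms and arguments matched, the total
weights would agree; so some factor is zero. -/
theorem cochains_le_weightForms (π : PolyPoisson n) (h m : ℕ) (w : ℤ) :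
    π.cochains h m w ≤ π.weightForms h m w := by
  refine Submodule.span_le.mpr ?_
  rintro _ ⟨a, φ, hφ, hw, rfl⟩ b f hf hb
  rw [wedgeForms_apply, Matrix.det_apply]
  refine Finset.sum_eq_zero fun ρ _ => ?_
  have : ∃ i, a i ≠ b (ρ i) := by
    by_contra! H
    apply hb
    rw [← hw, ← Equiv.sum_comp ρ]
    exact Finset.sum_congr rfl fun i _ => by rw [H i]
  obtain ⟨i, hi⟩ := this
  rw [Finset.prod_eq_zero (Finset.mem_univ i), smul_zero]
  exact hφ i (b (ρ i)) hi.symm _ (hf _)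

/-- With the shift `-2 + h`, weight is additive under the bracket, so replacing two arguments by
their bracket preserves the total weight. Evaluation suffices here; no expansion of the coboundary
into products is needed. -/
theorem ceCoboundary_mem_weightForms {π : PolyPoisson n} {h : ℕ} (hπ : π.IsHomog h) {k : ℕ} {w : ℤ}
    {σ : π.gbar [⋀^Fin (k + 1)]→ₗ[ℝ] ℝ} (hσ : σ ∈ π.weightForms h (k + 1) w) :
    ceCoboundary π.gbar (k + 1) σ ∈ π.weightForms h (k + 2) w := by
  intro b f hf hb
  change ceSum σ (fun i => π.toGbar (f i)) = 0
  rw [ceSum]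
  refine Finset.sum_eq_zero fun i _ => Finset.sum_eq_zero fun j hj => ?_
  have hij : i ≤ j := (Finset.mem_filter.mp hj).2
  have hji : i.castSucc.succAbove j = j.succ :=
    Fin.succAbove_of_le_castSucc _ _ (Fin.castSucc_le_castSucc_iff.mpr hij)
  refine mul_eq_zero_of_right _ ?_
  rw [lie_toGbar]
  rcases bracket_eq_zero_or_isHomogeneous hπ (hf i.castSucc) (hf j.succ) with h0 | ⟨c, hc, hom⟩
  · rw [h0, map_zero]
    exact σ.map_coord_zero 0 rfl
  · have := hσ (Matrix.vecCons c (j.removeNth (i.castSucc.removeNth b)))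
      (Matrix.vecCons (π.bracket (f i.castSucc) (f j.succ))
        (j.removeNth (i.castSucc.removeNth f))) ?_ ?_
    · rw [← this]
      congr 1
      funext r
      refine Fin.cases rfl (fun r => rfl) r
    · intro r
      refine Fin.cases hom (fun r => hf _) r
    · contrapose! hb
      rw [← hb, Fin.sum_univ_succAbove _ i.castSucc, Fin.sum_univ_succAbove _ j,
        Fin.sum_univ_succ, hji]
      simp only [Matrix.cons_val_zero, Matrix.cons_val_succ, Fin.removeNth_apply, hc]
      ring

/-! ### Forms of weight `w` in top degree and above -/

variable {h l : ℕ} {π : PolyPoisson n}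

theorem image_eq_monomialsUpTo_of_apply_ne_zero (hhl : 3 ≤ h + l) {m : ℕ}
    (hm : (monomialsUpTo n l).card ≤ m) {σ : π.gbar [⋀^Fin m]→ₗ[ℝ] ℝ}
    (hσ : σ ∈ π.weightForms h m (∑ s ∈ monomialsUpTo n l, ((s.degree : ℤ) - 2 + (h : ℤ))))
    {v : Fin m → Fin n →₀ ℕ} (hv : Function.Injective v) (h0 : ∀ i, v i ≠ 0)
    (hne : (σ fun i => π.mono (v i)) ≠ 0) :
    Finset.univ.image v = monomialsUpTo n l := by
  refine eq_monomialsUpTo_of_weight (h := h) hhl ?_ ?_ ?_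
  · intro s hs
    obtain ⟨i, -, rfl⟩ := Finset.mem_image.mp hs
    exact h0 i
  · rwa [Finset.card_image_of_injective _ hv, Finset.card_univ, Fintype.card_fin]
  · rw [Finset.sum_image fun i _ j _ hij => hv hij]
    by_contra hb
    exact hne (hσ (fun i => (v i).degree) (fun i => monomial (v i) 1)
      (fun i => isHomogeneous_monomial _ rfl) hb)

theorem weightForms_eq_bot (hhl : 3 ≤ h + l) {m : ℕ} (hm : (monomialsUpTo n l).card < m) :
    π.weightForms h m (∑ s ∈ monomialsUpTo n l, ((s.degree : ℤ) - 2 + (h : ℤ))) = ⊥ := by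
  refine (Submodule.eq_bot_iff _).mpr fun σ hσ => alternatingMap_ext_mono fun v hv h0 => ?_
  by_contra hne
  have := image_eq_monomialsUpTo_of_apply_ne_zero hhl hm.le hσ hv h0 hne
  rw [← this, Finset.card_image_of_injective _ hv, Finset.card_univ, Fintype.card_fin] at hm
  exact hm.false

theorem wedgeForms_coordForm_apply_mono {m : ℕ} {e : Fin m → Fin n →₀ ℕ}
    (he : Function.Injective e) (h0 : ∀ i, e i ≠ 0) :
    (wedgeForms (fun i => π.coordForm (e i)) fun i => π.mono (e i)) = 1 := by
  rw [wedgeForms_apply, ← Matrix.det_one (n := Fin m)]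
  congr 1
  ext i j
  rw [Matrix.of_apply, coordForm_mono π (h0 j), Matrix.one_apply]
  simp only [he.eq_iff]

/-- The top forms are multiples of the product of the coordinate forms. -/
theorem eq_smul_wedgeForms_of_mem_weightForms (hhl : 3 ≤ h + l) {m : ℕ} {e : Fin m → Fin n →₀ ℕ}
    (he : Function.Injective e) (hE : Finset.univ.image e = monomialsUpTo n l)
    (h0 : ∀ i, e i ≠ 0) {σ : π.gbar [⋀^Fin m]→ₗ[ℝ] ℝ}
    (hσ : σ ∈ π.weightForms h m (∑ s ∈ monomialsUpTo n l, ((s.degree : ℤ) - 2 + (h : ℤ)))) :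
    σ = (σ fun i => π.mono (e i)) • wedgeForms (fun i => π.coordForm (e i)) := by
  set w := ∑ s ∈ monomialsUpTo n l, ((s.degree : ℤ) - 2 + (h : ℤ)) with hw
  set τ := wedgeForms (fun i => π.coordForm (e i))
  have hτ : τ ∈ π.weightForms h m w := by
    refine cochains_le_weightForms _ _ _ _ (wedgeForms_coordForm_mem_cochains π h0 ?_)
    rw [hw, ← hE, Finset.sum_image fun i _ j _ hij => he hij]
  have hm : (monomialsUpTo n l).card = m := by
    rw [← hE, Finset.card_image_of_injective _ he, Finset.card_univ, Fintype.card_fin]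
  rw [← sub_eq_zero]
  refine alternatingMap_ext_mono fun v hv hv0 => ?_
  by_contra hne
  have himg := image_eq_monomialsUpTo_of_apply_ne_zero hhl hm.le
    (Submodule.sub_mem _ hσ (Submodule.smul_mem _ _ hτ)) hv hv0 hne
  -- The tuple `v` is a reordering of `e`, so the difference takes on it, up to sign, its value on
  -- `e`, which is zero.
  have hρ : ∀ i, ∃ j, e j = v i := fun i => by
    have : v i ∈ Finset.univ.image e := by
      rw [hE, ← himg]
      exact Finset.mem_image_of_mem _ (Finset.mem_univ i)
    obtain ⟨j, -, hj⟩ := Finset.mem_image.mp this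
    exact ⟨j, hj⟩
  choose ρ hρ using hρ
  have hρi : Function.Injective ρ := fun i j hij => hv (by rw [← hρ i, ← hρ j, hij])
  obtain ⟨ρ', rfl⟩ : ∃ ρ' : Equiv.Perm (Fin m), ⇑ρ' = ρ :=
    ⟨Equiv.ofBijective ρ (Finite.injective_iff_bijective.mp hρi), rfl⟩
  apply hne
  simp only [← hρ]
  have hperm := (σ - (σ fun i => π.mono (e i)) • τ).map_perm (fun i => π.mono (e i)) ρ'
  rw [Function.comp_def] at hperm
  rw [hperm, AlternatingMap.sub_apply, AlternatingMap.smul_apply,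
    wedgeForms_coordForm_apply_mono he h0]
  simp

/-! ### A form whose coboundary is the top form, up to a factor -/

/-- Each argument depends on one variable only, so a single term of the double sum is left: a
product of non-zero factors in an integral domain. -/
theorem bracket_monomial_single_ne_zero (hl : 1 ≤ l) {i j : Fin n} (hp : π.p i j ≠ 0) :
    π.bracket (monomial (Finsupp.single i l) 1) (monomial (Finsupp.single j l) 1) ≠ 0 := by
  have key : π.bracket (monomial (Finsupp.single i l) 1) (monomial (Finsupp.single j l) 1) =
      π.p i j * pderiv i (monomial (Finsupp.single i l) 1) *
        pderiv j (monomial (Finsupp.single j l) 1) := by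
    rw [bracket, Finset.sum_eq_single i, Finset.sum_eq_single j]
    · intro b _ hb
      have : pderiv b (monomial (Finsupp.single j l) (1 : ℝ)) = 0 := by
        rw [pderiv_monomial, Finsupp.single_eq_of_ne hb]
        simp
      simp [this]
    · simp
    · intro b _ hb
      refine Finset.sum_eq_zero fun c _ => ?_
      have : pderiv b (monomial (Finsupp.single i l) (1 : ℝ)) = 0 := by
        rw [pderiv_monomial, Finsupp.single_eq_of_ne hb]
        simp
      simp [this]
    · simp
  have hl' : (l : ℝ) ≠ 0 := Nat.cast_ne_zero.mpr (by omega)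
  rw [key]
  refine mul_ne_zero (mul_ne_zero hp ?_) ?_ <;>
  · rw [pderiv_monomial, Finsupp.single_eq_same, one_mul, Ne, monomial_eq_zero]
    exact hl'

/-- The coboundary of a product of coordinate forms on the monomials `a, b, e_1, …, e_k`, if the
forms are the coordinates `ν, e_1, …, e_k`: only the term of `⁅a, b⁆` is left. -/
theorem ceCoboundary_wedgeForms_coordForm_apply {k : ℕ} {a b ν : Fin n →₀ ℕ}
    {e : Fin k → Fin n →₀ ℕ} (he : Function.Injective e) (he0 : ∀ r, e r ≠ 0)
    (hν0 : ν ≠ 0) (hνa : ν ≠ a) (hνb : ν ≠ b) (hνe : ∀ r, ν ≠ e r) (hae : ∀ r, a ≠ e r)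
    (hbe : ∀ r, b ≠ e r) :
    (ceCoboundary π.gbar (k + 1)
      (wedgeForms fun r => π.coordForm (Matrix.vecCons (α := Fin n →₀ ℕ) ν e r))
      fun r => π.mono (Matrix.vecCons (α := Fin n →₀ ℕ) a (Matrix.vecCons b e) r)) =
      - π.coordForm ν ⁅π.mono a, π.mono b⁆ := by
  set φ : Fin (k + 1) → Module.Dual ℝ π.gbar :=
    fun r => π.coordForm (Matrix.vecCons (α := Fin n →₀ ℕ) ν e r) with hφ
  set v : Fin (k + 2) → π.gbar :=
    fun r => π.mono (Matrix.vecCons (α := Fin n →₀ ℕ) a (Matrix.vecCons b e) r) with hv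
  have hφa : ∀ r, φ r (π.mono a) = 0 := fun r => by
    refine Fin.cases ?_ (fun r => ?_) r
    · exact (coordForm_mono π hν0 a).trans (if_neg hνa.symm)
    · exact (coordForm_mono π (he0 r) a).trans (if_neg (hae r))
  have hφb : ∀ r, φ r (π.mono b) = 0 := fun r => by
    refine Fin.cases ?_ (fun r => ?_) r
    · exact (coordForm_mono π hν0 b).trans (if_neg hνb.symm)
    · exact (coordForm_mono π (he0 r) b).trans (if_neg (hbe r))
  have hzero : ∀ (u : Fin (k + 1) → π.gbar) (r : Fin (k + 1)), (∀ s, φ s (u r) = 0) →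
      wedgeForms φ u = 0 := fun u r hu => by
    rw [wedgeForms_apply]
    exact Matrix.det_eq_zero_of_row_eq_zero r hu
  change ceSum (wedgeForms φ) v = _
  -- Any pair other than the first two arguments leaves `a` or `b` in place, and all the forms
  -- vanish on it. The remaining pair has sign `(-1)^(0+1)`.
  rw [ceSum, Finset.sum_eq_single 0, Finset.sum_eq_single 0]
  · have hu : wedgeForms φ (Matrix.vecCons ⁅π.mono a, π.mono b⁆ fun r => π.mono (e r)) =
        π.coordForm ν ⁅π.mono a, π.mono b⁆ := by
      -- The coordinate of `ν` vanishes on every `e r`, so the first column has only its top entry;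
      -- the complementary minor is the identity.
      rw [wedgeForms_apply, Matrix.det_succ_column_zero, Finset.sum_eq_single 0]
      · have h1 : (Matrix.of fun i j => φ j (Matrix.vecCons ⁅π.mono a, π.mono b⁆
            (fun r => π.mono (e r)) i)).submatrix (Fin.succAbove 0) Fin.succ =
            (1 : Matrix (Fin k) (Fin k) ℝ) := by
          ext r s
          rw [Matrix.one_apply]
          exact (coordForm_mono π (he0 s) (e r)).trans (by simp only [he.eq_iff])
        rw [h1, Matrix.det_one]
        simp [hφ]
      · intro r _ hr
        obtain ⟨r, rfl⟩ := Fin.exists_succ_eq.mpr hr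
        have : φ 0 (π.mono (e r)) = 0 :=
          (coordForm_mono π hν0 (e r)).trans (if_neg (hνe r).symm)
        rw [Matrix.of_apply, Matrix.cons_val_succ, this]
        simp
      · simp
    rw [← hu]
    have hrest : (fun r => π.mono (e r)) =
        (0 : Fin (k + 1)).removeNth ((0 : Fin (k + 1)).castSucc.removeNth v) := by
      funext r
      simp only [Fin.removeNth_apply, Fin.castSucc_zero, Fin.succAbove_zero]
      rfl
    rw [← hrest]
    simp [hv]
  -- `a` is bracketed with a later argument than `b`, so `b` stands right after the bracket.
  · intro j _ hj
    obtain ⟨j, rfl⟩ := Fin.exists_succ_eq.mpr hj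
    refine mul_eq_zero_of_right _ ?_
    obtain ⟨k, rfl⟩ : ∃ k', k = k' + 1 := ⟨k - 1, by have := j.2; omega⟩
    refine hzero _ 1 fun s => ?_
    have : (Matrix.vecCons ⁅v (Fin.castSucc 0), v j.succ.succ⁆
        (j.succ.removeNth (Fin.removeNth (Fin.castSucc 0) v)) : Fin (k + 2) → π.gbar) 1 =
        π.mono b := by
      rw [← Fin.succ_zero_eq_one, Matrix.cons_val_succ]
      rw [Fin.removeNth_apply, Fin.succ_succAbove_zero, Fin.removeNth_apply, Fin.castSucc_zero,
        Fin.succAbove_zero]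
      rfl
    rw [this]
    exact hφb s
  · simp
  -- Here `a` is not bracketed and stands right after the bracket.
  · intro i _ hi
    obtain ⟨i, rfl⟩ := Fin.exists_succ_eq.mpr hi
    refine Finset.sum_eq_zero fun j hj => mul_eq_zero_of_right _ ?_
    obtain ⟨j, rfl⟩ := Fin.exists_succ_eq (x := j).mpr (by
      rintro rfl
      simp at hj)
    obtain ⟨k, rfl⟩ : ∃ k', k = k' + 1 := ⟨k - 1, by have := j.2; omega⟩
    refine hzero _ 1 fun s => ?_
    have : (Matrix.vecCons ⁅v i.succ.castSucc, v j.succ.succ⁆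
        (j.succ.removeNth (Fin.removeNth i.succ.castSucc v)) : Fin (k + 2) → π.gbar) 1 =
        π.mono a := by
      rw [← Fin.succ_zero_eq_one, Matrix.cons_val_succ]
      simp [Fin.removeNth_apply, hv]
    rw [this]
    exact hφa s
  · simp

end PolyPoisson

/-! ### The top Betti number -/

theorem mainTheorem4 (n h l : ℕ) (hl : 1 ≤ l) (hhl : 3 ≤ h + l)
    (π : PolyPoisson n) (hπ : π.IsHomog h) (hnt : π.Nontrivial)
    (w : ℤ) (hw : w = ∑ j ∈ Finset.Icc 1 l,
      ((j : ℤ) - 2 + (h : ℤ)) * (((n + j - 1).choose j : ℕ) : ℤ))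
    (m₀ : ℕ) (hm₀ : m₀ = ∑ j ∈ Finset.Icc 1 l, (n + j - 1).choose j) :
    IsGreatest {m : ℕ | π.cochains h m w ≠ ⊥} m₀ ∧
      Module.finrank ℝ (π.cochains h m₀ w) = 1 ∧
      Module.rank ℝ (π.Cohomology h m₀ w) = 0 := by
  rw [← sum_weight_monomialsUpTo] at hw
  rw [← card_monomialsUpTo] at hm₀
  obtain ⟨i, j, hp⟩ := hnt
  have hij : i ≠ j := by
    rintro rfl
    exact hp (self_eq_neg.mp (π.skew i i))
  set E := monomialsUpTo n l with hEdef
  set a : Fin n →₀ ℕ := Finsupp.single i l with ha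
  set b : Fin n →₀ ℕ := Finsupp.single j l with hb
  have hda : a.degree = l := Finsupp.degree_single i l
  have hdb : b.degree = l := Finsupp.degree_single j l
  have hab : a ≠ b := fun H => hij ((Finsupp.single_left_inj (by omega)).mp H)
  have haE : a ∈ E := mem_monomialsUpTo.mpr (by omega)
  have hbE : b ∈ E := mem_monomialsUpTo.mpr (by omega)
  set E' := (E.erase a).erase b with hE'
  have hbE' : b ∈ E.erase a := Finset.mem_erase.mpr ⟨hab.symm, hbE⟩
  obtain ⟨k, e, he, himg⟩ : ∃ (k : ℕ) (e : Fin k → Fin n →₀ ℕ),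
      Function.Injective e ∧ Finset.univ.image e = E' := by
    refine ⟨E'.card, fun r => (E'.equivFin.symm r).1,
      Subtype.val_injective.comp E'.equivFin.symm.injective, ?_⟩
    ext s
    simp only [Finset.mem_image, Finset.mem_univ, true_and]
    exact ⟨by rintro ⟨r, rfl⟩; exact (E'.equivFin.symm r).2,
      fun hs => ⟨E'.equivFin ⟨s, hs⟩, by simp⟩⟩
  have heE' : ∀ r, e r ∈ E' := fun r => himg ▸ Finset.mem_image_of_mem e (Finset.mem_univ r)
  have heE : ∀ r, e r ∈ E := fun r => Finset.mem_of_mem_erase (Finset.mem_of_mem_erase (heE' r))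
  have hE0 : ∀ s ∈ E, s ≠ 0 := by
    rintro s hs rfl
    have := mem_monomialsUpTo.mp hs
    simp at this
  have hae : ∀ r, a ≠ e r := fun r H => by
    have := heE' r
    rw [← H, hE'] at this
    simp at this
  have hbe : ∀ r, b ≠ e r := fun r H => by
    have := heE' r
    rw [← H, hE'] at this
    simp at this
  have hm : m₀ = k + 2 := by
    have h1 := Finset.card_erase_add_one haE
    have h2 := Finset.card_erase_add_one hbE'
    have h3 := Finset.card_image_of_injective Finset.univ he
    rw [himg, Finset.card_univ, Fintype.card_fin] at h3
    rw [← hE'] at h2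
    omega
  subst hm
  have hsum : ∑ r, (((e r).degree : ℤ) - 2 + (h : ℤ)) = w - 2 * ((l : ℤ) - 2 + h) := by
    have h1 := Finset.add_sum_erase E (fun s => (s.degree : ℤ) - 2 + (h : ℤ)) haE
    have h2 := Finset.add_sum_erase (E.erase a) (fun s => (s.degree : ℤ) - 2 + (h : ℤ)) hbE'
    have h3 := Finset.sum_image (s := Finset.univ) (g := e)
      (f := fun s => (s.degree : ℤ) - 2 + (h : ℤ)) fun r _ s _ hrs => he hrs
    rw [himg] at h3
    simp only [hda, hdb] at h1 h2
    linarith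
  -- An enumeration of `E` starting with `a, b`, the order in which the coboundary of `τ` is
  -- evaluated.
  set c : Fin (k + 2) → Fin n →₀ ℕ := Matrix.vecCons a (Matrix.vecCons b e) with hc
  have hcinj : Function.Injective c := by
    refine Fin.cons_injective_iff.mpr ⟨?_, Fin.cons_injective_iff.mpr ⟨?_, he⟩⟩
    · rintro ⟨r, hr⟩
      revert hr
      exact Fin.cases (fun hr => hab hr.symm) (fun r hr => hae r hr.symm) r
    · rintro ⟨r, hr⟩
      exact hbe r hr.symm
  have hc0 : ∀ r, c r ≠ 0 := fun r => Fin.cases (hE0 a haE)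
    (fun r => Fin.cases (hE0 b hbE) (fun r => hE0 _ (heE r)) r) r
  have hcE : Finset.univ.image c = E := by
    refine Finset.eq_of_subset_of_card_le ?_ ?_
    · intro s hs
      obtain ⟨r, -, rfl⟩ := Finset.mem_image.mp hs
      exact Fin.cases haE (fun r => Fin.cases hbE heE r) r
    · rw [Finset.card_image_of_injective _ hcinj, Finset.card_univ, Fintype.card_fin, hm₀]
  set top := wedgeForms fun r => π.coordForm (c r) with htop
  have htop1 : (top fun r => π.mono (c r)) = 1 :=
    PolyPoisson.wedgeForms_coordForm_apply_mono hcinj hc0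
  have htop0 : top ≠ 0 := by
    intro H
    rw [H, AlternatingMap.zero_apply] at htop1
    exact zero_ne_one htop1
  have htopC : top ∈ π.cochains h (k + 2) w := by
    refine PolyPoisson.wedgeForms_coordForm_mem_cochains π hc0 ?_
    rw [hw, ← hcE, Finset.sum_image fun i _ j _ hij => hcinj hij]
  have hmul : ∀ σ ∈ π.weightForms h (k + 2) w, σ = (σ fun r => π.mono (c r)) • top := by
    intro σ hσ
    rw [hw] at hσ
    exact PolyPoisson.eq_smul_wedgeForms_of_mem_weightForms hhl hcinj hcE hc0 hσ
  have hspan : π.cochains h (k + 2) w = Submodule.span ℝ {top} := by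
    refine le_antisymm (fun σ hσ => ?_) (by simpa using htopC)
    exact Submodule.mem_span_singleton.mpr
      ⟨_, (hmul σ (PolyPoisson.cochains_le_weightForms _ _ _ _ hσ)).symm⟩
  refine ⟨⟨fun H => htop0 (by simpa [H] using htopC), fun m hm => ?_⟩, ?_, ?_⟩
  · by_contra! hlt
    apply hm
    rw [hw, eq_bot_iff, ← PolyPoisson.weightForms_eq_bot hhl (hm₀ ▸ hlt)]
    exact PolyPoisson.cochains_le_weightForms _ _ _ _
  · rw [hspan, finrank_span_singleton htop0]
  · obtain ⟨ν, hν⟩ := ne_zero_iff.mp (PolyPoisson.bracket_monomial_single_ne_zero hl hp)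
    rw [← ha, ← hb] at hν
    have hνd : (ν.degree : ℤ) = l + l - 2 + h := by
      rcases PolyPoisson.bracket_eq_zero_or_isHomogeneous hπ
        (isHomogeneous_monomial (1 : ℝ) hda) (isHomogeneous_monomial (1 : ℝ) hdb) with
        h0 | ⟨d, hd, hom⟩
      · rw [h0, coeff_zero] at hν
        exact absurd rfl hν
      · rw [← hd, Nat.cast_inj]
        by_contra H
        exact hν (hom.coeff_eq_zero H)
    -- `2l - 2 + h > l` is exactly `h + l ≥ 3`.
    have hνE : ν ∉ E := fun H => by
      have := mem_monomialsUpTo.mp H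
      omega
    have hν0 : ν ≠ 0 := by
      rintro rfl
      rw [map_zero] at hνd
      omega
    have hνe : ∀ r, ν ≠ e r := fun r H => hνE (H ▸ heE r)
    set τ := wedgeForms fun r => π.coordForm (Matrix.vecCons (α := Fin n →₀ ℕ) ν e r) with hτdef
    -- The weight `2 (l - 2 + h)` of `ν` is that of `a` and `b` together.
    have hτ : τ ∈ π.cochains h (k + 1) w := by
      refine PolyPoisson.wedgeForms_coordForm_mem_cochains π
        (fun r => Fin.cases hν0 (fun r => hE0 _ (heE r)) r) ?_
      rw [Fin.sum_univ_succ]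
      simp only [Matrix.cons_val_zero, Matrix.cons_val_succ, hsum, hνd]
      ring
    have hdτ := hmul _ (PolyPoisson.ceCoboundary_mem_weightForms hπ
      (PolyPoisson.cochains_le_weightForms _ _ _ _ hτ))
    rw [PolyPoisson.ceCoboundary_wedgeForms_coordForm_apply he (fun r => hE0 _ (heE r)) hν0
      (fun H => hνE (H ▸ haE)) (fun H => hνE (H ▸ hbE)) hνe hae hbe, PolyPoisson.mono,
      PolyPoisson.mono, PolyPoisson.lie_toGbar, PolyPoisson.coordForm_toGbar π hν0] at hdτ
    -- All cochains in top degree are multiples of `top`, so it is enough to divide `τ` by the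
    -- non-zero factor in `hdτ`.
    have hle : π.cocycles h (k + 2) w ≤ π.coboundaries h (k + 2) w := by
      refine inf_le_left.trans ?_
      rw [hspan, Submodule.span_singleton_le_iff_mem]
      have := Submodule.smul_mem _ (-(coeff ν (π.bracket (monomial a 1) (monomial b 1))))⁻¹
        (Submodule.mem_map_of_mem (f := ceCoboundary π.gbar (k + 1)) hτ)
      rwa [hdτ, inv_smul_smul₀ (neg_ne_zero.mpr hν)] at this
    have : Subsingleton (π.Cohomology h (k + 2) w) :=
      Submodule.Quotient.subsingleton_iff.mpr (Submodule.submoduleOf_eq_top.mpr hle)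
    exact rank_subsingleton' _ _
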